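/- Let $l\ge n\ge 0$ be integers and let $x_1<x_2<\dots<x_{n+1}<t_{l+1}<\dots<t_2<t_1$ be real numbers. Let $A=(a_{i,j})$ be the $(l+1)\times(n+1)$ Lagrange--Vandermonde matrix with entries $$a_{i,j}=\prod_{\substack{k=1\\ k\ne j}}^{n+1}(t_i-x_k),\qquad 1\le i\le l+1,\ 1\le j\le n+1.$$ Recall the Neville elimination of an $r\times c$ matrix $B$: set $B^{(1)}=B$ and process the columns $j=1,2,\dots,c$ in turn. Let $\widetilde B^{(j)}$ be obtained from $B^{(j)}$ by moving to the bottom, if there are any, the rows of index $\ge j$ that have a zero entry in column $j$ (keeping the order otherwise). The pivots are $p_{i,j}=\widetilde b^{(j)}_{i,j}$ ($j\le i\le r$), those with $i=j$ being the diagonal pivots, and the multipliers are $m_{i,j}=p_{i,j}/p_{i-1,j}$ ($j<i\le r$), with $m_{i,j}=0$ if $p_{i-1,j}=0$. The matrix $B^{(j+1)}$ is obtained from $\widetilde B^{(j)}$ by subtracting from each row $i>j$ the multiple $m_{i,j}$ of row $i-1$ of $\widetilde B^{(j)}$. Then $A$ is strictly totally positive, that is, all its minors are positive, and $$A=F_lF_{l-1}\cdots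 F_1\,D\,G_1\cdots G_{n-1}G_n,$$ where - $F_i$ ($1\le i\le l$) is the $(l+1)\times(l+1)$ lower bidiagonal matrix with unit diagonal whose subdiagonal entry in row $q$ (position $(q,q-1)$) is $m_{q,q-i}$ for $i+1\le q\le l+1$, and $0$ for $2\le q\le i$; - $G_i^T$ ($1\le i\le n$) is the $(n+1)\times(n+1)$ lower bidiagonal matrix with unit diagonal whose subdiagonal entry in row $q$ is $\widetilde m_{q,q-i}$ for $i+1\le q\le n+1$, and $0$ for $2\le q\le i$; - $D$ is the $(l+1)\times(n+1)$ diagonal matrix $\mathrm{diag}\{p_{1,1},\dots,p_{n+1,n+1}\}$. Here $m_{i,j}$ and $\widetilde m_{i,j}$ are the multipliers of the Neville elimination of $A$ and of $A^T$, respectively (with $m_{i,j}=0$ for $j>n+1$), and $p_{i,i}$ are the diagonal pivots of the Neville elimination of $A$. They are given by $$m_{i,j}=(t_{i-j}-x_j)\,\frac{\prod_{k=i-j+1}^{i-1}(t_i-t_k)\ \prod_{k=j+1}^{n+1}(t_i-x_k)}{\prod_{k=i-j}^{i-2}(t_{i-1}-t_k)\ \prod_{k=j}^{n+1}(t_{i-1}-x_k)},\qquad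 1\le j\le n+1,\ j+1\le i\le l+1,$$ $$\widetilde m_{i,j}=(t_j-x_{i-j})\,\frac{\prod_{k=i-j+1}^{i-1}(x_i-x_k)\ \prod_{k=1}^{j-1}(t_k-x_{i-1})}{\prod_{k=i-j}^{i-2}(x_{i-1}-x_k)\ \prod_{k=1}^{j}(t_k-x_i)},\qquad 1\le j\le n,\ j+1\le i\le n+1,$$ $$p_{i,i}=\frac{\prod_{k=1}^{i-1}(t_k-t_i)\ \prod_{k=1}^{i-1}(x_i-x_k)\ \prod_{k=i+1}^{n+1}(t_i-x_k)}{\prod_{k=1}^{i-1}(t_k-x_i)},\qquad 1\le i\le n+1.$$ Empty products equal $1$. -/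

import Mathlib

noncomputable section

namespace LagrangeVandermonde

/-- A real matrix is strictly totally positive if all its minors are positive. -/
def IsSTP {r c : ℕ} (A : Matrix (Fin r) (Fin c) ℝ) : Prop :=
  ∀ (k : ℕ) (f : Fin k ↪o Fin r) (g : Fin k ↪o Fin c), 0 < (A.submatrix f g).det

/-- The `(l+1) × (n+1)` Lagrange-Vandermonde matrix: the entry in (1-based) row `i` and column `j`
is `∏_{1 ≤ k ≤ n+1, k ≠ j} (t_i - x_k)`. The nodes `x_1, …, x_{n+1}` and `t_1, …, t_{l+1}` are
the values of `x` and `t` at `1, …, n+1` and `1, …, l+1`. -/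
def lagrangeVandermonde (l n : ℕ) (x t : ℕ → ℝ) : Matrix (Fin (l + 1)) (Fin (n + 1)) ℝ :=
  Matrix.of fun i j => ∏ k ∈ (Finset.Icc 1 (n + 1)).erase (j.val + 1), (t (i.val + 1) - x k)

/-- Row moves before the elimination in column `k`: among the rows from the diagonal on
(`k ≤ i`), those with a zero entry in column `k` are moved to the bottom. The order is
otherwise kept (`Tuple.sort` is stable). -/
def nevilleReorder {r c : ℕ} (k : Fin c) (B : Matrix (Fin r) (Fin c) ℝ) :
    Matrix (Fin r) (Fin c) ℝ :=
  B.submatrix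
    (Tuple.sort fun i : Fin r => if k.val ≤ i.val ∧ B i k = 0 then (1 : ℕ) else 0) id

/-- Elimination in column `k`: from every row below the diagonal, subtract the multiple of the
preceding row that produces a zero in column `k`. Nothing is subtracted where the entry of the
preceding row is zero (the quotient is then `0`). -/
def nevilleEliminate {r c : ℕ} (k : Fin c) (B : Matrix (Fin r) (Fin c) ℝ) :
    Matrix (Fin r) (Fin c) ℝ :=
  Matrix.of fun i j =>
    if k.val < i.val then
      B i j - B i k / B ⟨i.val - 1, by omega⟩ k * B ⟨i.val - 1, by omega⟩ j
    else B i j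

/-- The matrices of the Neville elimination of `A`: `nevilleStage A k` is the matrix obtained
after the columns `1, …, k` have been processed. -/
def nevilleStage {r c : ℕ} (A : Matrix (Fin r) (Fin c) ℝ) : ℕ → Matrix (Fin r) (Fin c) ℝ
  | 0 => A
  | k + 1 =>
    if h : k < c then nevilleEliminate ⟨k, h⟩ (nevilleReorder ⟨k, h⟩ (nevilleStage A k))
    else nevilleStage A k

/-- The pivot `p_{i,j}` (1-based indices, `1 ≤ j ≤ i ≤ r`, `j ≤ c`) of the Neville elimination
of `A`: the `(i,j)` entry after the row moves for column `j`. It is `0` outside that range. -/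
def nevillePivot {r c : ℕ} (A : Matrix (Fin r) (Fin c) ℝ) (i j : ℕ) : ℝ :=
  if h : 1 ≤ j ∧ j ≤ i ∧ i ≤ r ∧ j ≤ c then
    nevilleReorder ⟨j - 1, by omega⟩ (nevilleStage A (j - 1)) ⟨i - 1, by omega⟩ ⟨j - 1, by omega⟩
  else 0

/-- The multiplier `m_{i,j} = p_{i,j} / p_{i-1,j}` (1-based indices, `1 ≤ j < i ≤ r`, `j ≤ c`)
of the Neville elimination of `A`; it is `0` if `p_{i-1,j} = 0`, and outside that range. -/
def nevilleMultiplier {r c : ℕ} (A : Matrix (Fin r) (Fin c) ℝ) (i j : ℕ) : ℝ :=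
  if j < i then nevillePivot A i j / nevillePivot A (i - 1) j else 0

/-- The `N × N` lower bidiagonal matrix with unit diagonal whose subdiagonal entry in (1-based)
row `q` is `m_{q,q-i}` for `q = i+1, …, N` and `0` for `q ≤ i`. -/
def bidiagonal (N : ℕ) (m : ℕ → ℕ → ℝ) (i : ℕ) : Matrix (Fin N) (Fin N) ℝ :=
  Matrix.of fun a b =>
    if a = b then 1
    else if a.val = b.val + 1 ∧ i ≤ a.val then m (a.val + 1) (a.val + 1 - i)
    else 0

/-- The `r × c` diagonal matrix with diagonal entries `p_1, p_2, …`. -/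
def rectDiagonal (r c : ℕ) (p : ℕ → ℝ) : Matrix (Fin r) (Fin c) ℝ :=
  Matrix.of fun a b => if a.val = b.val then p (a.val + 1) else 0

/-- The product `F_l F_{l-1} ⋯ F_1`. -/
def prodDown {N : ℕ} (F : ℕ → Matrix (Fin N) (Fin N) ℝ) (l : ℕ) : Matrix (Fin N) (Fin N) ℝ :=
  ((List.range l).reverse.map fun k => F (k + 1)).prod

/-- The product `G_1 G_2 ⋯ G_n`. -/
def prodUp {N : ℕ} (G : ℕ → Matrix (Fin N) (Fin N) ℝ) (n : ℕ) : Matrix (Fin N) (Fin N) ℝ :=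
  ((List.range n).map fun k => G (k + 1)).prod

end LagrangeVandermonde

end

/-!
Since `∏_{k ≠ j} (t_i - x_k) = w_i / (t_i - x_j)` with `w_i = ∏_k (t_i - x_k)`, the matrix is a
Cauchy matrix with scaled rows, and so are its submatrices; up to signs of the nodes the transpose
is a Cauchy matrix with scaled columns. For matrices with entries `w_i v_j / (a_i - b_j)` every
stage of the Neville elimination has a product formula, whose factors do not vanish when the nodes
are distinct. So no rows are ever exchanged, and all pivots and multipliers can be read off. The
determinant is the product of the diagonal pivots, which gives the positivity of the minors.

When no rows are exchanged, undoing the elimination writes `A = L U` with `L` the product of the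
bidiagonal matrices. Comparing this with the analogous `Aᵀ = G V` shows, as in the uniqueness of
the triangular factorization, that `U = D Gᵀ`.
-/

namespace LagrangeVandermonde

open Finset Matrix

/-! ### Triangular and trapezoidal matrices -/

section Triangular

variable {m R : Type*} [CommRing R]

/-- Lower triangular matrices with unit diagonal, the left factors of an `LU` factorization. -/
structure IsUnitLowerTriangular [LinearOrder m] (M : Matrix m m R) : Prop where
  isLowerTriangular : M.IsLowerTriangular
  apply_self : ∀ i, M i i = 1

namespace IsUnitLowerTriangular

variable [LinearOrder m] {M M' : Matrix m m R}

theorem one : IsUnitLowerTriangular (1 : Matrix m m R) :=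
  ⟨blockTriangular_one, one_apply_eq⟩

theorem isUpperTriangular_transpose (hM : IsUnitLowerTriangular M) : Mᵀ.IsUpperTriangular :=
  hM.isLowerTriangular.transpose

variable [Fintype m]

theorem mul (hM : IsUnitLowerTriangular M) (hM' : IsUnitLowerTriangular M') :
    IsUnitLowerTriangular (M * M') where
  isLowerTriangular := hM.isLowerTriangular.mul hM'.isLowerTriangular
  apply_self i := by
    rw [mul_apply, sum_eq_single i, hM.apply_self, hM'.apply_self, one_mul]
    · intro k _ hk
      rcases lt_or_gt_of_ne hk with hlt | hgt
      · rw [hM'.isLowerTriangular hlt, mul_zero]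
      · rw [hM.isLowerTriangular hgt, zero_mul]
    · simp

theorem det_eq_one (hM : IsUnitLowerTriangular M) : M.det = 1 := by
  rw [det_of_isLowerTriangular M hM.isLowerTriangular]
  exact prod_eq_one fun i _ => hM.apply_self i

theorem isUnit_det (hM : IsUnitLowerTriangular M) : IsUnit M.det :=
  hM.det_eq_one ▸ isUnit_one

theorem isUpperTriangular_transpose_inv (hM : IsUnitLowerTriangular M) :
    M⁻¹ᵀ.IsUpperTriangular := by
  have := invertibleOfIsUnitDet M hM.isUnit_det
  exact (blockTriangular_inv_of_blockTriangular hM.isLowerTriangular).transpose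

end IsUnitLowerTriangular

/-- Rectangular matrices that vanish below the main diagonal, the shape produced by elimination. -/
def IsUpperTrapezoidal {r c : ℕ} (U : Matrix (Fin r) (Fin c) R) : Prop :=
  ∀ ⦃i : Fin r⦄ ⦃j : Fin c⦄, j.val < i.val → U i j = 0

namespace IsUpperTrapezoidal

variable {r c : ℕ} {U : Matrix (Fin r) (Fin c) R} {T : Matrix (Fin c) (Fin c) R}

theorem mul (hU : IsUpperTrapezoidal U) (hT : T.IsUpperTriangular) :
    IsUpperTrapezoidal (U * T) := by
  intro i j hji
  rw [mul_apply]
  refine sum_eq_zero fun k _ => ?_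
  rcases lt_or_ge k.val i.val with hki | hik
  · rw [hU hki, zero_mul]
  · rw [hT (show j < k from hji.trans_le hik), mul_zero]

theorem mul_apply_diag (hU : IsUpperTrapezoidal U) (hT : T.IsUpperTriangular) {i : Fin r}
    {j : Fin c} (hij : i.val = j.val) : (U * T) i j = U i j * T j j := by
  rw [mul_apply, sum_eq_single j]
  · intro k _ hk
    rcases lt_or_gt_of_ne hk with hkj | hjk
    · rw [hU (show k.val < i.val from hij ▸ hkj), zero_mul]
    · rw [hT hjk, mul_zero]
  · simp

end IsUpperTrapezoidal

theorem eq_rectDiagonal {r c : ℕ} {E : Matrix (Fin r) (Fin c) ℝ} {p : ℕ → ℝ}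
    (hE : IsUpperTrapezoidal E) (hE' : IsUpperTrapezoidal Eᵀ)
    (hp : ∀ i j, i.val = j.val → E i j = p (i + 1)) : E = rectDiagonal r c p := by
  ext i j
  rw [rectDiagonal, of_apply]
  rcases lt_trichotomy i.val j.val with hij | hij | hji
  · rw [if_neg hij.ne]
    exact hE' hij
  · rw [if_pos hij, hp i j hij]
  · rw [if_neg hji.ne', hE hji]

theorem eq_rectDiagonal_mul_transpose {r c : ℕ} {L : Matrix (Fin r) (Fin r) ℝ}
    {G : Matrix (Fin c) (Fin c) ℝ} {U : Matrix (Fin r) (Fin c) ℝ} {V : Matrix (Fin c) (Fin r) ℝ}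
    {p : ℕ → ℝ} (hL : IsUnitLowerTriangular L) (hG : IsUnitLowerTriangular G)
    (hU : IsUpperTrapezoidal U) (hV : IsUpperTrapezoidal V) (h : L * U = (G * V)ᵀ)
    (hp : ∀ i j, i.val = j.val → U i j = p (i + 1)) : U = rectDiagonal r c p * Gᵀ := by
  obtain ⟨E, hE⟩ : ∃ E, E = U * G⁻¹ᵀ := ⟨_, rfl⟩
  have hUE : U = E * Gᵀ := by
    rw [hE, Matrix.mul_assoc, ← transpose_mul, mul_nonsing_inv _ hG.isUnit_det, transpose_one,
      Matrix.mul_one]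
  have hEV : Eᵀ = V * L⁻¹ᵀ := by
    have hLE : L * E = Vᵀ := by
      rw [hE, ← Matrix.mul_assoc, h, ← transpose_mul, nonsing_inv_mul_cancel_left _ _ hG.isUnit_det]
    rw [← transpose_transpose V, ← hLE, ← transpose_mul,
      nonsing_inv_mul_cancel_left _ _ hL.isUnit_det]
  have hE_upper : IsUpperTrapezoidal E := hE ▸ hU.mul hG.isUpperTriangular_transpose_inv
  have hE_lower : IsUpperTrapezoidal Eᵀ := hEV ▸ hV.mul hL.isUpperTriangular_transpose_inv
  have hE_diag : ∀ i j, i.val = j.val → E i j = p (i + 1) := fun i j hij => by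
    rw [← hp i j hij, hUE, hE_upper.mul_apply_diag hG.isUpperTriangular_transpose hij,
      transpose_apply, hG.apply_self, mul_one]
  rw [← eq_rectDiagonal hE_upper hE_lower hE_diag, ← hUE]

end Triangular

/-! ### Products of bidiagonal matrices -/

section Bidiagonal

variable {N c : ℕ} (m : ℕ → ℕ → ℝ) {i : ℕ} (B : Matrix (Fin N) (Fin c) ℝ)

theorem bidiagonal_mul_apply_of_lt {q : Fin N} (hq : q.val < i) (j : Fin c) :
    (bidiagonal N m i * B) q j = B q j := by
  simp [mul_apply, bidiagonal, hq.not_ge]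

theorem bidiagonal_mul_apply_of_le {q : ℕ} (hi : i ≤ q + 1) (hq : q + 1 < N) (j : Fin c) :
    (bidiagonal N m i * B) ⟨q + 1, hq⟩ j =
      B ⟨q + 1, hq⟩ j + m (q + 2) (q + 2 - i) * B ⟨q, by omega⟩ j := by
  rw [mul_apply, sum_eq_add (⟨q + 1, hq⟩ : Fin N) ⟨q, by omega⟩ (by simp)]
  · simp [bidiagonal, hi]
  · rintro b - ⟨hb, hb'⟩
    have : q ≠ b.val := fun h => hb' (Fin.ext h.symm)
    simp [bidiagonal, hb.symm, this]
  · simp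
  · simp

theorem isUnitLowerTriangular_bidiagonal (N i : ℕ) : IsUnitLowerTriangular (bidiagonal N m i) where
  isLowerTriangular a b hab := by
    have hlt : a.val < b.val := hab
    rw [bidiagonal, of_apply, if_neg (Fin.ne_of_lt hlt), if_neg (by omega)]
  apply_self a := by simp [bidiagonal]

theorem prodDown_succ (F : ℕ → Matrix (Fin N) (Fin N) ℝ) (l : ℕ) :
    prodDown F (l + 1) = F (l + 1) * prodDown F l := by
  simp [prodDown, List.range_succ]

theorem transpose_prodDown (F : ℕ → Matrix (Fin N) (Fin N) ℝ) (l : ℕ) :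
    (prodDown F l)ᵀ = prodUp (fun i => (F i)ᵀ) l := by
  rw [prodDown, prodUp, transpose_list_prod]
  simp [List.map_reverse, Function.comp_def]

theorem isUnitLowerTriangular_prodDown_bidiagonal (N l : ℕ) :
    IsUnitLowerTriangular (prodDown (bidiagonal N m) l) := by
  induction l with
  | zero => simpa [prodDown] using IsUnitLowerTriangular.one
  | succ l ih =>
    rw [prodDown_succ]
    exact (isUnitLowerTriangular_bidiagonal m N (l + 1)).mul ih

end Bidiagonal

/-! ### Neville elimination without row exchanges -/

/-- In no column does the Neville elimination of `A` meet a zero on or below the diagonal, so that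
it never moves a row. -/
def NevilleRegular {r c : ℕ} (A : Matrix (Fin r) (Fin c) ℝ) : Prop :=
  ∀ (k : Fin c) (i : Fin r), k.val ≤ i.val → nevilleStage A k i k ≠ 0

/-- The matrix `U` in the factorization `A = L U` given by Neville elimination. Its row `i` is
taken from stage `i`, after which the elimination leaves that row unchanged. -/
noncomputable def nevilleUpper {r c : ℕ} (A : Matrix (Fin r) (Fin c) ℝ) :
    Matrix (Fin r) (Fin c) ℝ :=
  of fun i j => nevilleStage A i i j

theorem nevilleReorder_eq_self {r c : ℕ} {k : Fin c} {B : Matrix (Fin r) (Fin c) ℝ}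
    (h : ∀ i : Fin r, k.val ≤ i.val → B i k ≠ 0) : nevilleReorder k B = B := by
  have hkey : (fun i : Fin r => if k.val ≤ i.val ∧ B i k = 0 then (1 : ℕ) else 0) = fun _ => 0 :=
    funext fun i => if_neg fun hi => h i hi.1 hi.2
  have hsort : Tuple.sort (fun _ : Fin r => (0 : ℕ)) = Equiv.refl _ :=
    Tuple.sort_eq_refl_iff_monotone.2 monotone_const
  rw [nevilleReorder, hkey, hsort]
  rfl

namespace NevilleRegular

variable {r c : ℕ} {A : Matrix (Fin r) (Fin c) ℝ}

theorem stage_succ (hA : NevilleRegular A) {k : ℕ} (hk : k < c) :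
    nevilleStage A (k + 1) = nevilleEliminate ⟨k, hk⟩ (nevilleStage A k) := by
  rw [nevilleStage, dif_pos hk, nevilleReorder_eq_self (hA ⟨k, hk⟩)]

theorem pivot_eq (hA : NevilleRegular A) {i k : ℕ} (hki : k ≤ i) (hi : i < r) (hk : k < c) :
    nevillePivot A (i + 1) (k + 1) = nevilleStage A k ⟨i, hi⟩ ⟨k, hk⟩ := by
  rw [nevillePivot, dif_pos (by omega)]
  simp only [Nat.add_sub_cancel]
  rw [nevilleReorder_eq_self (hA ⟨k, hk⟩)]

theorem stage_eq_add (hA : NevilleRegular A) {q k : ℕ} (hq : q + 1 < r) (hkq : k ≤ q) (j : Fin c) :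
    nevilleStage A k ⟨q + 1, hq⟩ j = nevilleStage A (k + 1) ⟨q + 1, hq⟩ j +
      nevilleMultiplier A (q + 2) (k + 1) * nevilleStage A k ⟨q, by omega⟩ j := by
  rw [nevilleMultiplier, if_pos (by omega), show q + 2 - 1 = q + 1 from rfl]
  by_cases hk : k < c
  · rw [hA.stage_succ hk, hA.pivot_eq (by omega) hq hk, hA.pivot_eq hkq (by omega) hk,
      nevilleEliminate, of_apply, if_pos (Nat.lt_succ_of_le hkq)]
    exact (sub_add_cancel _ _).symm
  · rw [nevillePivot, dif_neg (by omega), nevilleStage, dif_neg hk, zero_div, zero_mul, add_zero]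

theorem stage_eq_zero (hA : NevilleRegular A) {k : ℕ} (i : Fin r) (j : Fin c)
    (hji : j.val < i.val) (hjk : j.val < k) : nevilleStage A k i j = 0 := by
  induction k generalizing i with
  | zero => omega
  | succ k ih =>
    by_cases hk : k < c
    · rw [hA.stage_succ hk, nevilleEliminate, of_apply]
      have hpred : j.val ≤ (⟨i - 1, by omega⟩ : Fin r).val := Nat.le_pred_of_lt hji
      obtain rfl | hlt : j = ⟨k, hk⟩ ∨ j.val < k :=
        (Nat.le_of_lt_succ hjk).eq_or_lt.imp_left Fin.ext
      · rw [if_pos hji, div_mul_cancel₀ _ (hA _ _ hpred), sub_self]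
      · split_ifs with hki
        · rw [ih i hji hlt, ih ⟨i - 1, _⟩ (hlt.trans_le (Nat.le_pred_of_lt hki)) hlt, mul_zero,
            sub_zero]
        · exact ih i hji hlt
    · rw [nevilleStage, dif_neg hk]
      exact ih i hji (by omega)

theorem isUpperTrapezoidal_nevilleUpper (hA : NevilleRegular A) :
    IsUpperTrapezoidal (nevilleUpper A) :=
  fun i j hji => hA.stage_eq_zero i j hji hji

theorem prodDown_mul_nevilleUpper_apply (hA : NevilleRegular A) (i : ℕ) (q : Fin r) (j : Fin c) :
    (prodDown (bidiagonal r (nevilleMultiplier A)) i * nevilleUpper A) q j =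
      nevilleStage A (q - i) q j := by
  induction i generalizing q with
  | zero => simp [prodDown, nevilleUpper]
  | succ i ih =>
    rw [prodDown_succ, Matrix.mul_assoc]
    rcases Nat.lt_or_ge q.val (i + 1) with hqi | hiq
    · rw [bidiagonal_mul_apply_of_lt _ _ hqi, ih, Nat.sub_eq_zero_of_le hqi.le,
        Nat.sub_eq_zero_of_le (Nat.le_of_lt_succ hqi)]
    · obtain ⟨_ | q, hq⟩ := q
      · simp at hiq
      · rw [bidiagonal_mul_apply_of_le _ _ hiq, ih, ih]
        simp only at hiq ⊢
        rw [show q + 1 - i = q - i + 1 by omega, show q + 2 - (i + 1) = q - i + 1 by omega,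
          Nat.add_sub_add_right, ← hA.stage_eq_add hq (Nat.sub_le q i)]

theorem eq_prodDown_mul_nevilleUpper (hA : NevilleRegular A) {l : ℕ} (hl : r ≤ l + 1) :
    A = prodDown (bidiagonal r (nevilleMultiplier A)) l * nevilleUpper A := by
  ext q j
  rw [hA.prodDown_mul_nevilleUpper_apply, show q.val - l = 0 by omega, nevilleStage]

theorem nevilleUpper_apply_diag (hA : NevilleRegular A) (i : Fin r) (j : Fin c)
    (hij : i.val = j.val) : nevilleUpper A i j = nevillePivot A (i + 1) (i + 1) := by
  rw [hA.pivot_eq le_rfl i.isLt (hij ▸ j.isLt), nevilleUpper, of_apply]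
  exact congrArg (nevilleStage A i i) (Fin.ext hij.symm)

theorem factorization (hA : NevilleRegular A) (hA' : NevilleRegular Aᵀ) {l n : ℕ}
    (hl : r ≤ l + 1) (hn : c ≤ n + 1) :
    A = prodDown (bidiagonal r (nevilleMultiplier A)) l
        * rectDiagonal r c (fun i => nevillePivot A i i)
        * prodUp (fun i => (bidiagonal c (nevilleMultiplier Aᵀ) i)ᵀ) n := by
  have hLU := hA.eq_prodDown_mul_nevilleUpper hl
  have hGV := hA'.eq_prodDown_mul_nevilleUpper hn
  have hU := eq_rectDiagonal_mul_transpose (p := fun i => nevillePivot A i i)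
    (isUnitLowerTriangular_prodDown_bidiagonal (nevilleMultiplier A) r l)
    (isUnitLowerTriangular_prodDown_bidiagonal (nevilleMultiplier Aᵀ) c n)
    hA.isUpperTrapezoidal_nevilleUpper hA'.isUpperTrapezoidal_nevilleUpper
    (by rw [← hLU, ← hGV, transpose_transpose]) hA.nevilleUpper_apply_diag
  rw [← transpose_prodDown, Matrix.mul_assoc, ← hU, ← hLU]

theorem det_eq_prod_nevillePivot {A : Matrix (Fin r) (Fin r) ℝ} (hA : NevilleRegular A) :
    A.det = ∏ i : Fin r, nevillePivot A (i + 1) (i + 1) := by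
  have hdet := congrArg det (hA.eq_prodDown_mul_nevilleUpper (Nat.le_succ r))
  rw [det_mul, (isUnitLowerTriangular_prodDown_bidiagonal _ r r).det_eq_one, one_mul] at hdet
  rw [hdet, det_of_isUpperTriangular fun i j hji => hA.isUpperTrapezoidal_nevilleUpper hji]
  exact prod_congr rfl fun i _ => hA.nevilleUpper_apply_diag i i rfl

end NevilleRegular

/-! ### Neville elimination of matrices of Cauchy type -/

section CauchyLike

variable {K : Type*} [Field K]

/-- The matrix of Cauchy type with entries `w_i v_j / (a_i - b_j)`, for nodes and weights numbered
from `1`. -/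
def cauchyLike (r c : ℕ) (a b w v : ℕ → K) : Matrix (Fin r) (Fin c) K :=
  of fun i j => w (i + 1) * v (j + 1) / (a (i + 1) - b (j + 1))

theorem transpose_cauchyLike (r c : ℕ) (a b w v : ℕ → K) :
    (cauchyLike r c a b w v)ᵀ = cauchyLike c r (-b) (-a) v w := by
  ext i j
  simp only [transpose_apply, cauchyLike, of_apply, Pi.neg_apply]
  rw [neg_sub_neg, mul_comm]

/-- Distinct nodes and nonzero weights: the nondegeneracy condition under which the `r × c`
matrix of Cauchy type has no vanishing minors. -/
structure CauchyNondegenerate (r c : ℕ) (a b w v : ℕ → K) : Prop where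
  row_injOn : Set.InjOn a (Set.Icc 1 r)
  col_injOn : Set.InjOn b (Set.Icc 1 c)
  row_ne_col : ∀ i ∈ Set.Icc 1 r, ∀ j ∈ Set.Icc 1 c, a i ≠ b j
  row_weight_ne : ∀ i ∈ Set.Icc 1 r, w i ≠ 0
  col_weight_ne : ∀ j ∈ Set.Icc 1 c, v j ≠ 0

/-- The part of an entry of the `k`-th stage that depends on its row `i` only; the quotient of two
consecutive ones is the essential part of the multiplier. -/
def rowFactor (a b w : ℕ → K) (k i : ℕ) : K :=
  w i * (∏ s ∈ Ico (i - k) i, (a s - a i)) / ∏ s ∈ Icc 1 k, (a i - b s)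

/-- The part of an entry of the `k`-th stage that depends on its column `j` only. -/
def colFactor (b v : ℕ → K) (k j : ℕ) : K :=
  v j * ∏ s ∈ Icc 1 k, (b j - b s)

/-- The entry in row `i` and column `j`, numbered from `1`, of a matrix of Cauchy type after `k < i`
columns have been processed by Neville elimination. -/
def cauchyStage (a b w v : ℕ → K) (k i j : ℕ) : K :=
  rowFactor a b w k i * colFactor b v k j / ∏ s ∈ Ico (i - k) (i + 1), (a s - b j)

theorem rowFactor_succ (a b w : ℕ → K) {k i : ℕ} (hki : k ≤ i) :
    rowFactor a b w (k + 1) (i + 1) =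
      rowFactor a b w k (i + 1) * ((a (i - k) - a (i + 1)) / (a (i + 1) - b (k + 1))) := by
  rw [rowFactor, rowFactor, Nat.add_sub_add_right, prod_eq_prod_Ico_succ_bot (by omega),
    ← Nat.sub_add_comm hki, prod_Icc_succ_top (by omega), mul_left_comm, mul_comm (a (i - k) - _),
    mul_div_mul_comm]

theorem colFactor_succ (b v : ℕ → K) (k j : ℕ) :
    colFactor b v (k + 1) j = colFactor b v k j * (b j - b (k + 1)) := by
  rw [colFactor, colFactor, prod_Icc_succ_top (by omega), mul_assoc]

namespace CauchyNondegenerate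

variable {r c : ℕ} {a b w v : ℕ → K}

theorem transpose (h : CauchyNondegenerate r c a b w v) :
    CauchyNondegenerate c r (-b) (-a) v w where
  row_injOn := neg_injective.comp_injOn h.col_injOn
  col_injOn := neg_injective.comp_injOn h.row_injOn
  row_ne_col j hj i hi := neg_injective.ne (h.row_ne_col i hi j hj).symm
  row_weight_ne := h.col_weight_ne
  col_weight_ne := h.row_weight_ne

theorem row_sub_col_ne_zero (h : CauchyNondegenerate r c a b w v) {i j : ℕ} (hi : 1 ≤ i)
    (hir : i ≤ r) (hj : 1 ≤ j) (hjc : j ≤ c) : a i - b j ≠ 0 :=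
  sub_ne_zero.2 (h.row_ne_col i ⟨hi, hir⟩ j ⟨hj, hjc⟩)

theorem prod_row_sub_col_ne_zero (h : CauchyNondegenerate r c a b w v) {p q j : ℕ} (hp : 1 ≤ p)
    (hqr : q ≤ r + 1) (hj : 1 ≤ j) (hjc : j ≤ c) : ∏ s ∈ Ico p q, (a s - b j) ≠ 0 :=
  prod_ne_zero_iff.2 fun s hs => by
    rw [mem_Ico] at hs
    exact h.row_sub_col_ne_zero (by omega) (by omega) hj hjc

theorem rowFactor_ne_zero (h : CauchyNondegenerate r c a b w v) {k i : ℕ} (hki : k < i)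
    (hir : i ≤ r) (hkc : k ≤ c) : rowFactor a b w k i ≠ 0 := by
  refine div_ne_zero (mul_ne_zero (h.row_weight_ne i ⟨by omega, hir⟩) ?_) ?_ <;>
    refine prod_ne_zero_iff.2 fun s hs => ?_
  · rw [mem_Ico] at hs
    exact sub_ne_zero.2 (h.row_injOn.ne ⟨by omega, by omega⟩ ⟨by omega, hir⟩ hs.2.ne)
  · rw [mem_Icc] at hs
    exact h.row_sub_col_ne_zero (by omega) hir hs.1 (hs.2.trans hkc)

theorem colFactor_ne_zero (h : CauchyNondegenerate r c a b w v) {k j : ℕ} (hkj : k < j)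
    (hjc : j ≤ c) : colFactor b v k j ≠ 0 := by
  refine mul_ne_zero (h.col_weight_ne j ⟨by omega, hjc⟩) (prod_ne_zero_iff.2 fun s hs => ?_)
  rw [mem_Icc] at hs
  exact sub_ne_zero.2 (h.col_injOn.ne ⟨by omega, hjc⟩ ⟨hs.1, by omega⟩ (by omega))

theorem cauchyStage_ne_zero (h : CauchyNondegenerate r c a b w v) {k i : ℕ} (hki : k < i)
    (hir : i ≤ r) (hkc : k < c) : cauchyStage a b w v k i (k + 1) ≠ 0 :=
  div_ne_zero
    (mul_ne_zero (h.rowFactor_ne_zero hki hir hkc.le) (h.colFactor_ne_zero k.lt_succ_self hkc))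
    (h.prod_row_sub_col_ne_zero (by omega) (by omega) (by omega) hkc)

theorem cauchyStage_div (h : CauchyNondegenerate r c a b w v) {k i : ℕ} (hki : k < i)
    (hir : i < r) (hkc : k < c) :
    cauchyStage a b w v k (i + 1) (k + 1) / cauchyStage a b w v k i (k + 1) =
      rowFactor a b w k (i + 1) / rowFactor a b w k i *
        ((a (i - k) - b (k + 1)) / (a (i + 1) - b (k + 1))) := by
  have hcol := h.colFactor_ne_zero k.lt_succ_self hkc
  have hrow := h.rowFactor_ne_zero hki hir.le hkc.le
  have hprod := h.prod_row_sub_col_ne_zero (p := i + 1 - k) (q := i + 1) (j := k + 1)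
    (by omega) (by omega) (by omega) hkc
  have hbot := h.row_sub_col_ne_zero (i := i - k) (j := k + 1)
    (by omega) (by omega) (by omega) hkc
  have htop := h.row_sub_col_ne_zero (i := i + 1) (j := k + 1)
    (by omega) (by omega) (by omega) hkc
  rw [cauchyStage, cauchyStage, prod_Ico_succ_top (by omega) (fun s => a s - b (k + 1)),
    prod_eq_prod_Ico_succ_bot (show i - k < i + 1 by omega), ← Nat.sub_add_comm hki.le]
  field_simp

theorem cauchyStage_succ (h : CauchyNondegenerate r c a b w v) {k i j : ℕ} (hki : k < i)
    (hir : i < r) (hkc : k < c) (hj : 1 ≤ j) (hjc : j ≤ c) :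
    cauchyStage a b w v (k + 1) (i + 1) j = cauchyStage a b w v k (i + 1) j -
      cauchyStage a b w v k (i + 1) (k + 1) / cauchyStage a b w v k i (k + 1) *
        cauchyStage a b w v k i j := by
  have hrow := h.rowFactor_ne_zero hki hir.le hkc.le
  have hprod := h.prod_row_sub_col_ne_zero (p := i + 1 - k) (q := i + 1) (by omega) (by omega)
    hj hjc
  have hbot := h.row_sub_col_ne_zero (i := i - k) (by omega) (by omega) hj hjc
  have htop := h.row_sub_col_ne_zero (i := i + 1) (by omega) (by omega) hj hjc
  have hpiv := h.row_sub_col_ne_zero (i := i + 1) (j := k + 1) (by omega) (by omega) (by omega) hkc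
  rw [h.cauchyStage_div hki hir hkc, cauchyStage, cauchyStage, cauchyStage,
    rowFactor_succ a b w hki.le, colFactor_succ, Nat.add_sub_add_right,
    prod_Ico_succ_top (b := i + 1) (by omega), prod_Ico_succ_top (a := i + 1 - k) (by omega),
    prod_eq_prod_Ico_succ_bot (show i - k < i + 1 by omega), ← Nat.sub_add_comm hki.le]
  field_simp
  ring

end CauchyNondegenerate

end CauchyLike

section NevilleCauchyLike

variable {r c : ℕ} {a b w v : ℕ → ℝ}

theorem nevilleStage_cauchyLike (h : CauchyNondegenerate r c a b w v) {k : ℕ} (hkc : k ≤ c)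
    (i : Fin r) (j : Fin c) :
    nevilleStage (cauchyLike r c a b w v) k i j =
      cauchyStage a b w v (min k i) (i + 1) (j + 1) := by
  induction k generalizing i j with
  | zero => simp [nevilleStage, cauchyLike, cauchyStage, rowFactor, colFactor]
  | succ k ih =>
    have hk : k < c := hkc
    have ih' := ih hk.le
    have hpivot : ∀ i : Fin r, k ≤ i.val →
        nevilleStage (cauchyLike r c a b w v) k i ⟨k, hk⟩ ≠ 0 := fun i hki => by
      rw [ih', min_eq_left hki]
      exact h.cauchyStage_ne_zero (Nat.lt_succ_of_le hki) i.isLt hk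
    rw [nevilleStage, dif_pos hk, nevilleReorder_eq_self hpivot, nevilleEliminate, of_apply]
    simp only [ih']
    split_ifs with hki
    · obtain ⟨_ | i, hi⟩ := i
      · simp at hki
      · simp only [Nat.add_sub_cancel] at hki ⊢
        rw [min_eq_left hki.le, min_eq_left (Nat.le_of_lt_succ hki), min_eq_left hki,
          h.cauchyStage_succ hki hi hk (Nat.succ_pos _) j.isLt]
    · rw [min_eq_right (not_lt.1 hki), min_eq_right (by omega)]

theorem nevilleRegular_cauchyLike (h : CauchyNondegenerate r c a b w v) :
    NevilleRegular (cauchyLike r c a b w v) := by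
  intro k i hki
  rw [nevilleStage_cauchyLike h k.isLt.le, min_eq_left hki]
  exact h.cauchyStage_ne_zero (Nat.lt_succ_of_le hki) i.isLt k.isLt

theorem nevillePivot_cauchyLike (h : CauchyNondegenerate r c a b w v) {i k : ℕ} (hki : k < i)
    (hir : i ≤ r) (hkc : k < c) :
    nevillePivot (cauchyLike r c a b w v) i (k + 1) = cauchyStage a b w v k i (k + 1) := by
  obtain ⟨i, rfl⟩ := Nat.exists_eq_add_of_lt (Nat.zero_lt_of_lt hki)
  rw [zero_add] at hki hir ⊢
  rw [(nevilleRegular_cauchyLike h).pivot_eq (Nat.le_of_lt_succ hki) hir hkc,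
    nevilleStage_cauchyLike h hkc.le, min_eq_left (Nat.le_of_lt_succ hki)]

theorem nevilleMultiplier_cauchyLike (h : CauchyNondegenerate r c a b w v) {i k : ℕ} (hki : k < i)
    (hir : i < r) (hkc : k < c) :
    nevilleMultiplier (cauchyLike r c a b w v) (i + 1) (k + 1) =
      rowFactor a b w k (i + 1) / rowFactor a b w k i *
        ((a (i - k) - b (k + 1)) / (a (i + 1) - b (k + 1))) := by
  rw [nevilleMultiplier, if_pos (Nat.succ_lt_succ hki), Nat.add_sub_cancel,
    nevillePivot_cauchyLike h (by omega) hir hkc, nevillePivot_cauchyLike h hki hir.le hkc,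
    h.cauchyStage_div hki hir hkc]

theorem factorization_cauchyLike (h : CauchyNondegenerate (r + 1) (c + 1) a b w v) :
    cauchyLike (r + 1) (c + 1) a b w v =
      prodDown (bidiagonal (r + 1) (nevilleMultiplier (cauchyLike (r + 1) (c + 1) a b w v))) r
        * rectDiagonal (r + 1) (c + 1)
            (fun i => nevillePivot (cauchyLike (r + 1) (c + 1) a b w v) i i)
        * prodUp (fun i => (bidiagonal (c + 1)
            (nevilleMultiplier (cauchyLike (r + 1) (c + 1) a b w v)ᵀ) i)ᵀ) c := by
  refine (nevilleRegular_cauchyLike h).factorization ?_ le_rfl le_rfl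
  rw [transpose_cauchyLike]
  exact nevilleRegular_cauchyLike h.transpose

end NevilleCauchyLike

/-! ### Total positivity of matrices of Cauchy type -/

section TotalPositivity

variable {a b w v : ℕ → ℝ}

theorem cauchyStage_pos {k i j : ℕ} (hki : k < i) (hkj : k < j)
    (ha : StrictAntiOn a (Set.Icc 1 i)) (hb : StrictMonoOn b (Set.Icc 1 j))
    (hab : ∀ p ∈ Set.Icc 1 i, ∀ q ∈ Set.Icc 1 j, b q < a p) (hw : 0 < w i) (hv : 0 < v j) :
    0 < cauchyStage a b w v k i j := by
  have hi : i ∈ Set.Icc 1 i := ⟨by omega, le_rfl⟩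
  have hj : j ∈ Set.Icc 1 j := ⟨by omega, le_rfl⟩
  have hrow : 0 < rowFactor a b w k i := by
    refine div_pos (mul_pos hw (prod_pos fun s hs => sub_pos.2 ?_))
      (prod_pos fun s hs => sub_pos.2 ?_)
    · rw [mem_Ico] at hs
      exact ha ⟨by omega, hs.2.le⟩ hi hs.2
    · rw [mem_Icc] at hs
      exact hab i hi s ⟨hs.1, by omega⟩
  have hcol : 0 < colFactor b v k j := by
    refine mul_pos hv (prod_pos fun s hs => sub_pos.2 ?_)
    rw [mem_Icc] at hs
    exact hb ⟨hs.1, by omega⟩ hj (by omega)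
  refine div_pos (mul_pos hrow hcol) (prod_pos fun s hs => sub_pos.2 ?_)
  rw [mem_Ico] at hs
  exact hab s ⟨by omega, by omega⟩ j hj

theorem det_cauchyLike_pos {k : ℕ} (ha : StrictAntiOn a (Set.Icc 1 k))
    (hb : StrictMonoOn b (Set.Icc 1 k))
    (hab : ∀ i ∈ Set.Icc 1 k, ∀ j ∈ Set.Icc 1 k, b j < a i)
    (hw : ∀ i ∈ Set.Icc 1 k, 0 < w i) (hv : ∀ j ∈ Set.Icc 1 k, 0 < v j) :
    0 < (cauchyLike k k a b w v).det := by
  have h : CauchyNondegenerate k k a b w v :=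
    ⟨ha.injOn, hb.injOn, fun i hi j hj => (hab i hi j hj).ne', fun i hi => (hw i hi).ne',
      fun j hj => (hv j hj).ne'⟩
  rw [(nevilleRegular_cauchyLike h).det_eq_prod_nevillePivot]
  refine prod_pos fun i _ => ?_
  have hsub : Set.Icc 1 (i.val + 1) ⊆ Set.Icc 1 k := Set.Icc_subset_Icc_right i.isLt
  have hi : i.val + 1 ∈ Set.Icc 1 k := ⟨by omega, i.isLt⟩
  rw [nevillePivot_cauchyLike h i.val.lt_succ_self i.isLt i.isLt]
  exact cauchyStage_pos i.val.lt_succ_self i.val.lt_succ_self (ha.mono hsub) (hb.mono hsub)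
    (fun p hp q hq => hab p (hsub hp) q (hsub hq)) (hw _ hi) (hv _ hi)

theorem exists_strictMonoOn_eq_orderEmbedding {k r : ℕ} (f : Fin k ↪o Fin r) :
    ∃ F : ℕ → ℕ, (∀ i : Fin k, F (i + 1) = f i + 1) ∧ StrictMonoOn F (Set.Icc 1 k) ∧
      Set.MapsTo F (Set.Icc 1 k) (Set.Icc 1 r) := by
  have hinj : Function.Injective fun i : Fin k => i.val + 1 := fun i j hij =>
    Fin.ext (Nat.succ_injective hij)
  obtain ⟨F, hF⟩ := hinj.surjective_comp_right fun i => (f i).val + 1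
  replace hF : ∀ i : Fin k, F (i + 1) = f i + 1 := congrFun hF
  refine ⟨F, hF, ?_, ?_⟩
  · rintro (_ | i) ⟨hi, hik⟩ (_ | j) ⟨hj, hjk⟩ hij
    iterate 3 omega
    have hlt : (⟨i, hik⟩ : Fin k) < ⟨j, hjk⟩ := Nat.lt_of_succ_lt_succ hij
    rw [hF ⟨i, hik⟩, hF ⟨j, hjk⟩]
    exact Nat.succ_lt_succ (f.strictMono hlt)
  · rintro (_ | i) ⟨hi, hik⟩
    · omega
    · rw [hF ⟨i, hik⟩]
      exact ⟨Nat.succ_pos _, (f ⟨i, hik⟩).isLt⟩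

theorem isSTP_cauchyLike {r c : ℕ} (ha : StrictAntiOn a (Set.Icc 1 r))
    (hb : StrictMonoOn b (Set.Icc 1 c))
    (hab : ∀ i ∈ Set.Icc 1 r, ∀ j ∈ Set.Icc 1 c, b j < a i)
    (hw : ∀ i ∈ Set.Icc 1 r, 0 < w i) (hv : ∀ j ∈ Set.Icc 1 c, 0 < v j) :
    IsSTP (cauchyLike r c a b w v) := by
  intro k f g
  obtain ⟨F, hF, hF_mono, hF_maps⟩ := exists_strictMonoOn_eq_orderEmbedding f
  obtain ⟨G, hG, hG_mono, hG_maps⟩ := exists_strictMonoOn_eq_orderEmbedding g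
  have hsub : (cauchyLike r c a b w v).submatrix f g =
      cauchyLike k k (a ∘ F) (b ∘ G) (w ∘ F) (v ∘ G) := by
    ext i j
    simp [cauchyLike, hF, hG]
  rw [hsub]
  exact det_cauchyLike_pos (ha.comp_strictMonoOn hF_mono hF_maps) (hb.comp hG_mono hG_maps)
    (fun i hi j hj => hab _ (hF_maps hi) _ (hG_maps hj)) (fun i hi => hw _ (hF_maps hi))
    (fun j hj => hv _ (hG_maps hj))

end TotalPositivity

/-! ### The Lagrange-Vandermonde matrix -/

/-- The value at `t_i` of the nodal polynomial of `x_1, …, x_{n+1}`, the weight of row `i` of the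
Lagrange-Vandermonde matrix as a matrix of Cauchy type. -/
noncomputable def nodalWeight (n : ℕ) (x t : ℕ → ℝ) (i : ℕ) : ℝ :=
  (Lagrange.nodal (Icc 1 (n + 1)) x).eval (t i)

section Nodes

variable {l n : ℕ} {x t : ℕ → ℝ}

theorem col_node_lt_row_node (hx : StrictMonoOn x (Set.Icc 1 (n + 1)))
    (ht : StrictAntiOn t (Set.Icc 1 (l + 1))) (hxt : x (n + 1) < t (l + 1)) {i j : ℕ}
    (hi : i ∈ Set.Icc 1 (l + 1)) (hj : j ∈ Set.Icc 1 (n + 1)) : x j < t i :=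
  calc
    x j ≤ x (n + 1) := hx.monotoneOn hj ⟨by omega, le_rfl⟩ hj.2
    _ < t (l + 1) := hxt
    _ ≤ t i := ht.antitoneOn hi ⟨by omega, le_rfl⟩ hi.2

theorem lagrangeVandermonde_eq_cauchyLike
    (hxt : ∀ i ∈ Set.Icc 1 (l + 1), ∀ j ∈ Set.Icc 1 (n + 1), t i ≠ x j) :
    lagrangeVandermonde l n x t = cauchyLike (l + 1) (n + 1) t x (nodalWeight n x t) 1 := by
  ext i j
  have hij : t (i + 1) - x (j + 1) ≠ 0 :=
    sub_ne_zero.2 (hxt _ ⟨by omega, by omega⟩ _ ⟨by omega, by omega⟩)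
  rw [lagrangeVandermonde, cauchyLike, of_apply, of_apply, nodalWeight, Lagrange.eval_nodal,
    Pi.one_apply, mul_one, eq_div_iff hij, prod_erase_mul _ _ (mem_Icc.2 ⟨by omega, by omega⟩)]

theorem cauchyNondegenerate_nodalWeight (hx : Set.InjOn x (Set.Icc 1 (n + 1)))
    (ht : Set.InjOn t (Set.Icc 1 (l + 1)))
    (hxt : ∀ i ∈ Set.Icc 1 (l + 1), ∀ j ∈ Set.Icc 1 (n + 1), t i ≠ x j) :
    CauchyNondegenerate (l + 1) (n + 1) t x (nodalWeight n x t) 1 where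
  row_injOn := ht
  col_injOn := hx
  row_ne_col := hxt
  row_weight_ne i hi := Lagrange.eval_nodal_not_at_node fun j hj => hxt i hi j (mem_Icc.1 hj)
  col_weight_ne _ _ := one_ne_zero

theorem isSTP_lagrangeVandermonde (hx : StrictMonoOn x (Set.Icc 1 (n + 1)))
    (ht : StrictAntiOn t (Set.Icc 1 (l + 1)))
    (hxt : ∀ i ∈ Set.Icc 1 (l + 1), ∀ j ∈ Set.Icc 1 (n + 1), x j < t i) :
    IsSTP (lagrangeVandermonde l n x t) := by
  rw [lagrangeVandermonde_eq_cauchyLike fun i hi j hj => (hxt i hi j hj).ne']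
  refine isSTP_cauchyLike ht hx hxt (fun i hi => ?_) fun _ _ => one_pos
  rw [nodalWeight, Lagrange.eval_nodal]
  exact prod_pos fun j hj => sub_pos.2 (hxt i hi j (mem_Icc.1 hj))

theorem rowFactor_nodalWeight {k i : ℕ} (hk : k ≤ n + 1)
    (hxt : ∀ j ∈ Set.Icc 1 (n + 1), t i ≠ x j) :
    rowFactor t x (nodalWeight n x t) k i =
      (∏ s ∈ Ico (i - k) i, (t s - t i)) * ∏ s ∈ Icc (k + 1) (n + 1), (t i - x s) := by
  have hsplit : (∏ s ∈ Icc 1 k, (t i - x s)) * ∏ s ∈ Icc (k + 1) (n + 1), (t i - x s) =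
      nodalWeight n x t i := by
    rw [nodalWeight, Lagrange.eval_nodal]
    simp only [← Ico_add_one_right_eq_Icc]
    exact prod_Ico_consecutive _ (by omega) (by omega)
  have hne : ∏ s ∈ Icc 1 k, (t i - x s) ≠ 0 := prod_ne_zero_iff.2 fun s hs =>
    sub_ne_zero.2 (hxt s ⟨(mem_Icc.1 hs).1, (mem_Icc.1 hs).2.trans hk⟩)
  rw [rowFactor, ← hsplit]
  field_simp

theorem prod_sub_div_prod_sub_comm {ι K : Type*} [Field K] {S T : Finset ι} (hST : #S = #T)
    (f : ι → K) (y z : K) :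
    (∏ s ∈ S, (f s - y)) / ∏ s ∈ T, (f s - z) = (∏ s ∈ S, (y - f s)) / ∏ s ∈ T, (z - f s) := by
  have hneg : ∀ (S : Finset ι) (y : K),
      ∏ s ∈ S, (f s - y) = (-1) ^ #S * ∏ s ∈ S, (y - f s) := fun S y => by
    rw [← prod_const, ← prod_mul_distrib]
    exact prod_congr rfl fun s _ => by ring
  rw [hneg S, hneg T, hST, mul_div_mul_left _ _ (pow_ne_zero _ (neg_ne_zero.2 one_ne_zero))]

theorem nevilleMultiplier_lagrangeVandermonde (hx : Set.InjOn x (Set.Icc 1 (n + 1)))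
    (ht : Set.InjOn t (Set.Icc 1 (l + 1)))
    (hxt : ∀ i ∈ Set.Icc 1 (l + 1), ∀ j ∈ Set.Icc 1 (n + 1), t i ≠ x j) {i j : ℕ}
    (hj : 1 ≤ j) (hjn : j ≤ n + 1) (hji : j + 1 ≤ i) (hil : i ≤ l + 1) :
    nevilleMultiplier (lagrangeVandermonde l n x t) i j =
      (t (i - j) - x j) *
        (((∏ k ∈ Icc (i - j + 1) (i - 1), (t i - t k)) * ∏ k ∈ Icc (j + 1) (n + 1), (t i - x k)) /
          ((∏ k ∈ Icc (i - j) (i - 2), (t (i - 1) - t k)) *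
            ∏ k ∈ Icc j (n + 1), (t (i - 1) - x k))) := by
  obtain ⟨i, rfl⟩ : ∃ i', i = i' + 1 := ⟨i - 1, by omega⟩
  obtain ⟨k, rfl⟩ : ∃ k, j = k + 1 := ⟨j - 1, by omega⟩
  have hne : t (i + 1) - x (k + 1) ≠ 0 := sub_ne_zero.2 (hxt _ ⟨by omega, hil⟩ _ ⟨hj, hjn⟩)
  have hIcc : Icc (i - k + 1) i = Ico (i + 1 - k) (i + 1) := by ext; simp; omega
  have hIcc' : Icc (i - k) (i + 1 - 2) = Ico (i - k) i := by ext; simp; omega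
  have hsign := prod_sub_div_prod_sub_comm (S := Ico (i + 1 - k) (i + 1)) (T := Ico (i - k) i)
    (by simp only [Nat.card_Ico]; omega) t (t (i + 1)) (t i)
  rw [lagrangeVandermonde_eq_cauchyLike hxt,
    nevilleMultiplier_cauchyLike (cauchyNondegenerate_nodalWeight hx ht hxt) (by omega) (by omega)
      (by omega),
    rowFactor_nodalWeight (by omega) (hxt _ ⟨by omega, hil⟩),
    rowFactor_nodalWeight (by omega) (hxt _ ⟨by omega, by omega⟩),
    mul_div_mul_comm, hsign, ← mul_prod_Ioc_eq_prod_Icc (f := fun s => t (i + 1) - x s) hjn,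
    ← Icc_add_one_left_eq_Ioc, Nat.add_sub_add_right, Nat.add_sub_cancel, hIcc, hIcc']
  field_simp

theorem nevilleMultiplier_transpose_lagrangeVandermonde (hx : Set.InjOn x (Set.Icc 1 (n + 1)))
    (ht : Set.InjOn t (Set.Icc 1 (l + 1)))
    (hxt : ∀ i ∈ Set.Icc 1 (l + 1), ∀ j ∈ Set.Icc 1 (n + 1), t i ≠ x j) {i j : ℕ}
    (hj : 1 ≤ j) (hjl : j ≤ l + 1) (hji : j + 1 ≤ i) (hin : i ≤ n + 1) :
    nevilleMultiplier (lagrangeVandermonde l n x t)ᵀ i j =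
      (t j - x (i - j)) *
        (((∏ k ∈ Icc (i - j + 1) (i - 1), (x i - x k)) * ∏ k ∈ Icc 1 (j - 1), (t k - x (i - 1))) /
          ((∏ k ∈ Icc (i - j) (i - 2), (x (i - 1) - x k)) * ∏ k ∈ Icc 1 j, (t k - x i))) := by
  obtain ⟨i, rfl⟩ : ∃ i', i = i' + 1 := ⟨i - 1, by omega⟩
  obtain ⟨k, rfl⟩ : ∃ k, j = k + 1 := ⟨j - 1, by omega⟩
  have hIcc : Icc (i - k + 1) i = Ico (i + 1 - k) (i + 1) := by ext; simp; omega
  have hIcc' : Icc (i - k) (i + 1 - 2) = Ico (i - k) i := by ext; simp; omega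
  rw [lagrangeVandermonde_eq_cauchyLike hxt, transpose_cauchyLike,
    nevilleMultiplier_cauchyLike (cauchyNondegenerate_nodalWeight hx ht hxt).transpose (by omega)
      (by omega) (by omega), rowFactor, rowFactor, Nat.add_sub_add_right, Nat.add_sub_cancel,
    Nat.add_sub_cancel, hIcc, hIcc', prod_Icc_succ_top (show 1 ≤ k + 1 by omega)]
  simp only [Pi.neg_apply, neg_sub_neg, Pi.one_apply, one_mul]
  rw [div_div_div_eq, div_mul_div_comm]
  ring

theorem nevillePivot_lagrangeVandermonde (hx : Set.InjOn x (Set.Icc 1 (n + 1)))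
    (ht : Set.InjOn t (Set.Icc 1 (l + 1)))
    (hxt : ∀ i ∈ Set.Icc 1 (l + 1), ∀ j ∈ Set.Icc 1 (n + 1), t i ≠ x j) {i : ℕ}
    (hi : 1 ≤ i) (hin : i ≤ n + 1) (hil : i ≤ l + 1) :
    nevillePivot (lagrangeVandermonde l n x t) i i =
      ((∏ k ∈ Icc 1 (i - 1), (t k - t i)) * (∏ k ∈ Icc 1 (i - 1), (x i - x k)) *
          ∏ k ∈ Icc (i + 1) (n + 1), (t i - x k)) /
        ∏ k ∈ Icc 1 (i - 1), (t k - x i) := by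
  obtain ⟨i, rfl⟩ : ∃ i', i = i' + 1 := ⟨i - 1, by omega⟩
  have hne : t (i + 1) - x (i + 1) ≠ 0 := sub_ne_zero.2 (hxt _ ⟨hi, hil⟩ _ ⟨hi, hin⟩)
  rw [lagrangeVandermonde_eq_cauchyLike hxt,
    nevillePivot_cauchyLike (cauchyNondegenerate_nodalWeight hx ht hxt) (by omega) hil (by omega),
    cauchyStage, colFactor, rowFactor_nodalWeight (by omega) (hxt _ ⟨hi, hil⟩),
    ← mul_prod_Ioc_eq_prod_Icc (f := fun s => t (i + 1) - x s) hin, ← Icc_add_one_left_eq_Ioc,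
    Nat.add_sub_cancel, Nat.add_sub_cancel_left, Pi.one_apply,
    prod_Ico_succ_top (by omega) (fun s => t s - x (i + 1)), Ico_add_one_right_eq_Icc]
  field_simp

end Nodes

end LagrangeVandermonde

open LagrangeVandermonde Finset Matrix in
theorem theorem1_general (l n : ℕ) (x t : ℕ → ℝ) (hx : Set.InjOn x (Set.Icc 1 (n + 1)))
    (ht : Set.InjOn t (Set.Icc 1 (l + 1)))
    (hxt : ∀ i ∈ Set.Icc 1 (l + 1), ∀ j ∈ Set.Icc 1 (n + 1), t i ≠ x j)
    (A : Matrix (Fin (l + 1)) (Fin (n + 1)) ℝ) (hA : A = lagrangeVandermonde l n x t) :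
    (StrictMonoOn x (Set.Icc 1 (n + 1)) → StrictAntiOn t (Set.Icc 1 (l + 1)) →
      x (n + 1) < t (l + 1) → IsSTP A) ∧
    A = prodDown (bidiagonal (l + 1) (nevilleMultiplier A)) l
        * rectDiagonal (l + 1) (n + 1) (fun i => nevillePivot A i i)
        * prodUp (fun i => (bidiagonal (n + 1) (nevilleMultiplier Aᵀ) i)ᵀ) n ∧
    (∀ i j : ℕ, 1 ≤ j → j ≤ n + 1 → j + 1 ≤ i → i ≤ l + 1 →
      nevilleMultiplier A i j =
        (t (i - j) - x j) *
          (((∏ k ∈ Icc (i - j + 1) (i - 1), (t i - t k)) *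
              ∏ k ∈ Icc (j + 1) (n + 1), (t i - x k)) /
            ((∏ k ∈ Icc (i - j) (i - 2), (t (i - 1) - t k)) *
              ∏ k ∈ Icc j (n + 1), (t (i - 1) - x k)))) ∧
    (∀ i j : ℕ, 1 ≤ j → j ≤ l + 1 → j + 1 ≤ i → i ≤ n + 1 →
      nevilleMultiplier Aᵀ i j =
        (t j - x (i - j)) *
          (((∏ k ∈ Icc (i - j + 1) (i - 1), (x i - x k)) *
              ∏ k ∈ Icc 1 (j - 1), (t k - x (i - 1))) /
            ((∏ k ∈ Icc (i - j) (i - 2), (x (i - 1) - x k)) *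
              ∏ k ∈ Icc 1 j, (t k - x i)))) ∧
    (∀ i : ℕ, 1 ≤ i → i ≤ n + 1 → i ≤ l + 1 →
      nevillePivot A i i =
        ((∏ k ∈ Icc 1 (i - 1), (t k - t i)) * (∏ k ∈ Icc 1 (i - 1), (x i - x k)) *
            ∏ k ∈ Icc (i + 1) (n + 1), (t i - x k)) /
          ∏ k ∈ Icc 1 (i - 1), (t k - x i)) := by
  subst hA
  refine ⟨fun hx' ht' hxt' => isSTP_lagrangeVandermonde hx' ht' fun i hi j hj =>
      col_node_lt_row_node hx' ht' hxt' hi hj, ?_,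
    fun i j => nevilleMultiplier_lagrangeVandermonde hx ht hxt,
    fun i j => nevilleMultiplier_transpose_lagrangeVandermonde hx ht hxt,
    fun i => nevillePivot_lagrangeVandermonde hx ht hxt⟩
  rw [lagrangeVandermonde_eq_cauchyLike hxt]
  exact factorization_cauchyLike (cauchyNondegenerate_nodalWeight hx ht hxt)

theorem theorem1 (l n : ℕ) (hln : n ≤ l) (x t : ℕ → ℝ)
    (hx : StrictMonoOn x (Set.Icc 1 (n + 1)))
    (ht : StrictAntiOn t (Set.Icc 1 (l + 1)))
    (hxt : x (n + 1) < t (l + 1))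
    (A : Matrix (Fin (l + 1)) (Fin (n + 1)) ℝ)
    (hA : A = LagrangeVandermonde.lagrangeVandermonde l n x t) :
    LagrangeVandermonde.IsSTP A ∧
    A = LagrangeVandermonde.prodDown
          (fun i => LagrangeVandermonde.bidiagonal (l + 1)
            (LagrangeVandermonde.nevilleMultiplier A) i) l
        * LagrangeVandermonde.rectDiagonal (l + 1) (n + 1)
            (fun i => LagrangeVandermonde.nevillePivot A i i)
        * LagrangeVandermonde.prodUp
          (fun i => (LagrangeVandermonde.bidiagonal (n + 1)
            (LagrangeVandermonde.nevilleMultiplier A.transpose) i).transpose) n ∧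
    (∀ i j : ℕ, 1 ≤ j → j ≤ n + 1 → j + 1 ≤ i → i ≤ l + 1 →
      LagrangeVandermonde.nevilleMultiplier A i j =
        (t (i - j) - x j) *
          (((∏ k ∈ Finset.Icc (i - j + 1) (i - 1), (t i - t k)) *
              ∏ k ∈ Finset.Icc (j + 1) (n + 1), (t i - x k)) /
            ((∏ k ∈ Finset.Icc (i - j) (i - 2), (t (i - 1) - t k)) *
              ∏ k ∈ Finset.Icc j (n + 1), (t (i - 1) - x k)))) ∧
    (∀ i j : ℕ, 1 ≤ j → j ≤ n → j + 1 ≤ i → i ≤ n + 1 →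
      LagrangeVandermonde.nevilleMultiplier A.transpose i j =
        (t j - x (i - j)) *
          (((∏ k ∈ Finset.Icc (i - j + 1) (i - 1), (x i - x k)) *
              ∏ k ∈ Finset.Icc 1 (j - 1), (t k - x (i - 1))) /
            ((∏ k ∈ Finset.Icc (i - j) (i - 2), (x (i - 1) - x k)) *
              ∏ k ∈ Finset.Icc 1 j, (t k - x i)))) ∧
    (∀ i : ℕ, 1 ≤ i → i ≤ n + 1 →
      LagrangeVandermonde.nevillePivot A i i =
        ((∏ k ∈ Finset.Icc 1 (i - 1), (t k - t i)) *
            (∏ k ∈ Finset.Icc 1 (i - 1), (x i - x k)) *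
            ∏ k ∈ Finset.Icc (i + 1) (n + 1), (t i - x k)) /
          ∏ k ∈ Finset.Icc 1 (i - 1), (t k - x i)) := by
  obtain ⟨hSTP, hfact, hm, hm', hp⟩ := theorem1_general l n x t hx.injOn ht.injOn
    (fun i hi j hj => (LagrangeVandermonde.col_node_lt_row_node hx ht hxt hi hj).ne') A hA
  exact ⟨hSTP hx ht hxt, hfact, hm, fun i j hj hjn => hm' i j hj (by omega),
    fun i hi hin => hp i hi hin (by omega)⟩
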